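/- Let $G_k=\{g\in O(n): g^2=1,\ \operatorname{Tr} g=n-2k\}$ be the Grassmannian of $k$-dimensional subspaces of $\mathbb R^n$, a subspace $V$ being identified with the reflection that is $-1$ on $V$ and $+1$ on $V^\perp$. Let $B^+\subset SL_n(\mathbb R)$ be the group of upper triangular matrices of determinant $1$ with positive diagonal. Let $\tilde w$ be a signed permutation matrix, $\tilde w(e_i)=\epsilon_i e_{w(i)}$ with $w\in S_n$ and $\epsilon_i\in\{\pm1\}$, such that $\tilde w^2=1$ and $\operatorname{Tr}\tilde w=n-2k$ (that is, $\tilde w\in G_k$). Let $\mathfrak B_{\tilde w}=G_k\cap B^+\tilde wB^+$ be its Bruhat cell, and let $\mathfrak A_{\tilde w}$ be the set of real $n\times n$ matrices $A$ such that - $A$ is symmetric and positive definite, - $\tilde w^{-1}A\tilde w=A$, - $A_{i,i}=1$ for all $i$, and $A_{i,j}=0$ whenever $i<j$ and $w(i)<w(j)$. Let $d=|\mathrm{Inv}(w)/{\sim}|$, where $\mathrm{Inv}(w)=\{(i,j): i<j,\ w(i)>w(j)\}$ and $(i,j)\sim(w(j),w(i))$. Then: 1. $\mathfrak A_{\tilde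 w}$ is non-empty, convex and open in its affine span, and this affine span has dimension $d$. 2. Every $A\in\mathfrak A_{\tilde w}$ has a unique Cholesky factorization $A=\alpha^{\mathsf T}\alpha$ with $\alpha$ upper triangular with positive diagonal, and $A\mapsto\alpha\tilde w\alpha^{-1}$ is a homeomorphism from $\mathfrak A_{\tilde w}$ onto $\mathfrak B_{\tilde w}$. 3. $\mathfrak B_{\tilde w}$ is an open cell of dimension $d$, i.e. it is homeomorphic to the open unit ball of $\mathbb R^d$. -/

import Mathlib

open scoped Matrix

namespace BruhatGrassmann

/-- The Grassmannian of `k`-dimensional subspaces of `ℝⁿ`, where a subspace `V` is identified with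
the reflection that is `-1` on `V` and `+1` on the orthogonal complement of `V`. -/
def grassmannian (n k : ℕ) : Set (Matrix (Fin n) (Fin n) ℝ) :=
  {g | g ∈ Matrix.orthogonalGroup (Fin n) ℝ ∧ g * g = 1 ∧ g.trace = (n : ℝ) - 2 * (k : ℝ)}

/-- Upper triangular matrices with positive diagonal (no condition on the determinant). -/
def IsPosUpper {n : ℕ} (a : Matrix (Fin n) (Fin n) ℝ) : Prop :=
  a.BlockTriangular id ∧ ∀ i, 0 < a i i

/-- `B⁺`: the upper triangular matrices in `SL_n(ℝ)` with positive diagonal. -/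
def borelPos (n : ℕ) : Set (Matrix (Fin n) (Fin n) ℝ) :=
  {b | IsPosUpper b ∧ b.det = 1}

/-- The signed permutation matrix that sends the basis vector `e_i` to `ε_i e_{w(i)}`. -/
def signedPerm {n : ℕ} (w : Equiv.Perm (Fin n)) (ε : Fin n → ℤˣ) : Matrix (Fin n) (Fin n) ℝ :=
  Matrix.of fun a i => if a = w i then ((ε i : ℤ) : ℝ) else 0

/-- The Bruhat cell `G_k ∩ B⁺ W B⁺` of a matrix `W`. -/
def bruhatCell {n : ℕ} (k : ℕ) (W : Matrix (Fin n) (Fin n) ℝ) : Set (Matrix (Fin n) (Fin n) ℝ) :=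
  grassmannian n k ∩ {g | ∃ b ∈ borelPos n, ∃ c ∈ borelPos n, g = b * W * c}

/-- The normalized, positive definite matrices that are invariant under conjugation with the
signed permutation matrix of `(w, ε)`. Over `ℝ`, `Matrix.PosDef` includes symmetry. -/
def normalMatrices {n : ℕ} (w : Equiv.Perm (Fin n)) (ε : Fin n → ℤˣ) :
    Set (Matrix (Fin n) (Fin n) ℝ) :=
  {A | A.PosDef ∧ (signedPerm w ε)⁻¹ * A * signedPerm w ε = A ∧
    (∀ i, A i i = 1) ∧ ∀ i j, i < j → w i < w j → A i j = 0}

/-- The inversions of a permutation. -/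
def Inversions {n : ℕ} (w : Equiv.Perm (Fin n)) : Type :=
  {p : Fin n × Fin n // p.1 < p.2 ∧ w p.2 < w p.1}

/-- The inversions of `w` modulo the equivalence relation generated by `(i,j) ~ (w(j), w(i))`. -/
def InversionClasses {n : ℕ} (w : Equiv.Perm (Fin n)) : Type :=
  Quot fun p q : Inversions w => q.1 = (w p.1.2, w p.1.1)

/-- The number of inversions of `w` modulo `(i,j) ~ (w(j), w(i))`. -/
noncomputable def cellDim {n : ℕ} (w : Equiv.Perm (Fin n)) : ℕ :=
  Nat.card (InversionClasses w)

/-- `a` is the Cholesky factor of `A`: upper triangular, positive diagonal, and `A = aᵀ a`. -/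
def IsCholesky {n : ℕ} (A a : Matrix (Fin n) (Fin n) ℝ) : Prop :=
  IsPosUpper a ∧ aᵀ * a = A

end BruhatGrassmann

/-! Write W for the signed permutation matrix. If g = bWc lies in the cell, then g² = W² = 1 gives g
c⁻¹ = bW and g b = c⁻¹W. So d = b + c⁻¹, again upper triangular with positive diagonal, satisfies g
d = d W. Since g is orthogonal, the Gram matrix dᵀd is W-invariant.

The remaining freedom is d ↦ dγ with γ positive upper triangular and commuting with W. Such γ vanish
at inversions, because conjugation by W moves those entries below the diagonal. Gram–Schmidt for the
partial order "i < j and w i < w j" uses exactly this freedom. It is canonical, hence W-equivariant,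
and makes the Gram matrix normal (`exists_of_mem_bruhatCell`). Rigidity of Gram–Schmidt
(`eq_one_of_isReduced`) makes the normalized intertwiner unique (`eq_of_intertwines`).

Continuity both ways comes from compactness: a unit diagonal of aᵀa bounds the entries of a, and
uniqueness identifies every limit. For this, uniqueness is proved assuming only a nonnegative
diagonal, the condition that survives limits.

The normal matrices are the positive definite points of 1 + `tangentSpace w ε`, whose free
coordinates are the entries at classes of inversions. These entries have absolute value at most 1,
so the set is a bounded open convex set, hence a ball. -/

namespace BruhatGrassmann

open Matrix Filter Topology

/-! ### Gram–Schmidt orthogonalization along a relation -/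

section GramSchmidt

variable {n : ℕ}

theorem posDef_dotProduct_pos {B : Matrix (Fin n) (Fin n) ℝ} (hB : B.PosDef) {x : Fin n → ℝ}
    (hx : x ≠ 0) : 0 < x ⬝ᵥ (B *ᵥ x) := by
  simpa using hB.dotProduct_mulVec_pos hx

theorem posDef_transpose_eq {B : Matrix (Fin n) (Fin n) ℝ} (hB : B.PosDef) : Bᵀ = B := by
  simpa [Matrix.IsHermitian] using hB.isHermitian

/-- Each term of xᵀBx vanishes, either through x or through Bx. -/
theorem eq_zero_of_supported {B : Matrix (Fin n) (Fin n) ℝ} (hB : B.PosDef) {S : Set (Fin n)}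
    {x : Fin n → ℝ} (hx : ∀ m, m ∉ S → x m = 0) (hBx : ∀ l ∈ S, (B *ᵥ x) l = 0) : x = 0 := by
  by_contra h
  refine (posDef_dotProduct_pos hB h).ne' (Finset.sum_eq_zero fun l _ => ?_)
  by_cases hl : l ∈ S
  · rw [hBx l hl, mul_zero]
  · rw [hx l hl, zero_mul]

/-- `x` is the normalized component of the basis vector `e_j` orthogonal, with respect to `B`,
to the basis vectors indexed by `S`. -/
structure IsOrthoColumn (B : Matrix (Fin n) (Fin n) ℝ) (S : Set (Fin n)) (j : Fin n)
    (x : Fin n → ℝ) : Prop where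
  supported : ∀ m, m ≠ j → m ∉ S → x m = 0
  ortho : ∀ l ∈ S, (B *ᵥ x) l = 0
  norm : x ⬝ᵥ (B *ᵥ x) = 1
  nonneg : 0 ≤ x j

theorem IsOrthoColumn.pos {B : Matrix (Fin n) (Fin n) ℝ} (hB : B.PosDef) {S : Set (Fin n)}
    {j : Fin n} {x : Fin n → ℝ} (h : IsOrthoColumn B S j x) : 0 < x j := by
  refine h.nonneg.lt_of_ne' fun h0 => ?_
  have : x = 0 := eq_zero_of_supported hB (S := S) (fun m hm => by
    by_cases hmj : m = j
    · rw [hmj, h0]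
    · exact h.supported m hmj hm) h.ortho
  simpa [this] using h.norm

/-- The combination y_j x − x_j y has no j-th entry, so it is supported on S and B-orthogonal to S,
hence zero. Thus x and y are proportional, and norm and sign fix the factor. -/
theorem IsOrthoColumn.unique {B : Matrix (Fin n) (Fin n) ℝ} (hB : B.PosDef) {S : Set (Fin n)}
    {j : Fin n} {x y : Fin n → ℝ} (hx : IsOrthoColumn B S j x) (hy : IsOrthoColumn B S j y) :
    x = y := by
  have hd : y j • x - x j • y = 0 := by
    refine eq_zero_of_supported hB (S := S) (fun m hm => ?_) fun l hl => ?_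
    · by_cases hmj : m = j
      · subst hmj; simp [mul_comm]
      · simp [hx.supported m hmj hm, hy.supported m hmj hm]
    · simp [Matrix.mulVec_sub, Matrix.mulVec_smul, hx.ortho l hl, hy.ortho l hl]
  have he : y j • x = x j • y := sub_eq_zero.1 hd
  have hn : (y j • x) ⬝ᵥ (B *ᵥ (y j • x)) = (x j • y) ⬝ᵥ (B *ᵥ (x j • y)) := by rw [he]
  simp only [Matrix.mulVec_smul, smul_dotProduct, dotProduct_smul, hx.norm, hy.norm,
    smul_eq_mul, mul_one] at hn
  have hxy : y j = x j := by nlinarith [hx.pos hB, hy.pos hB]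
  rw [hxy] at he
  exact smul_right_injective _ (hx.pos hB).ne' he

/-- The B-orthogonal projection of e_j onto the span of S is found by inverting the principal
submatrix of B on S, so S needs no order. -/
theorem exists_isOrthoColumn {B : Matrix (Fin n) (Fin n) ℝ} (hB : B.PosDef) (S : Set (Fin n))
    (j : Fin n) (hj : j ∉ S) : ∃ x, IsOrthoColumn B S j x := by
  classical
  let C : Matrix S S ℝ := B.submatrix (fun s => (s : Fin n)) fun s => (s : Fin n)
  have hC : C.PosDef := hB.submatrix Subtype.val_injective
  let y : S → ℝ := C⁻¹ *ᵥ fun s => B s j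
  have hy : C *ᵥ y = fun s : S => B s j := by
    rw [Matrix.mulVec_mulVec, Matrix.mul_nonsing_inv _ ((Matrix.isUnit_iff_isUnit_det _).1 hC.isUnit),
      Matrix.one_mulVec]
  let z : Fin n → ℝ := fun m => if h : m ∈ S then y ⟨m, h⟩ else 0
  have hz : ∀ l ∈ S, (B *ᵥ z) l = B l j := by
    intro l hl
    rw [← congrFun hy ⟨l, hl⟩]
    simp only [Matrix.mulVec, dotProduct]
    rw [← Finset.sum_subset (Finset.subset_univ (Finset.univ.filter (· ∈ S)))]
    · rw [Finset.sum_subtype (p := (· ∈ S)) _ (by simp)]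
      refine Finset.sum_congr rfl fun s _ => ?_
      simp [z, C]
    · intro m _ hm
      have : m ∉ S := by simpa using hm
      simp [z, this]
  let u : Fin n → ℝ := Pi.single j 1 - z
  have huj : u j = 1 := by simp [u, z, hj]
  have hu0 : u ≠ 0 := fun h => by simp [h] at huj
  have hpos := posDef_dotProduct_pos hB hu0
  set q := u ⬝ᵥ (B *ᵥ u) with hq
  refine ⟨(Real.sqrt q)⁻¹ • u, ⟨fun m hmj hm => ?_, fun l hl => ?_, ?_, ?_⟩⟩
  · simp [u, z, hmj, hm]
  · simp [Matrix.mulVec_smul, u, Matrix.mulVec_sub, hz l hl]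
  · simp only [Matrix.mulVec_smul, smul_dotProduct, dotProduct_smul, smul_eq_mul, ← hq]
    rw [← mul_assoc, ← mul_inv, Real.mul_self_sqrt hpos.le, inv_mul_cancel₀ hpos.ne']
  · simp [huj]

/-- The columns of `g` are the result of orthogonalizing each basis vector against those that
precede it for the relation `r`. -/
def IsOrthogonalizer (r : Fin n → Fin n → Prop) (B g : Matrix (Fin n) (Fin n) ℝ) : Prop :=
  ∀ j, IsOrthoColumn B {l | r l j} j (g.col j)

/-- Unit diagonal, and zero entries at the pairs related by `r`. -/
def IsReduced (r : Fin n → Fin n → Prop) (A : Matrix (Fin n) (Fin n) ℝ) : Prop :=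
  (∀ i, A i i = 1) ∧ ∀ i j, r i j → A i j = 0

theorem IsOrthogonalizer.unique {r : Fin n → Fin n → Prop} {B g h : Matrix (Fin n) (Fin n) ℝ}
    (hB : B.PosDef) (hg : IsOrthogonalizer r B g) (hh : IsOrthogonalizer r B h) : g = h := by
  ext i j
  exact congrFun ((hg j).unique hB (hh j)) i

theorem exists_isOrthogonalizer {r : Fin n → Fin n → Prop} (hr : ∀ i, ¬ r i i)
    {B : Matrix (Fin n) (Fin n) ℝ} (hB : B.PosDef) : ∃ g, IsOrthogonalizer r B g := by
  choose x hx using fun j => exists_isOrthoColumn hB {l | r l j} j (hr j)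
  exact ⟨Matrix.of fun i j => x j i, hx⟩

theorem transpose_mul_mul_apply (B g : Matrix (Fin n) (Fin n) ℝ) (i j : Fin n) :
    (gᵀ * B * g) i j = g.col i ⬝ᵥ (B *ᵥ g.col j) := by
  rw [Matrix.mul_assoc, Matrix.mul_apply]
  simp [dotProduct, Matrix.mulVec, Matrix.mul_apply]

/-- By transitivity, if `r i j` then column i is supported on predecessors of j, where B applied to
column j vanishes. -/
theorem IsOrthogonalizer.isReduced {r : Fin n → Fin n → Prop}
    (htrans : ∀ i j l, r i j → r j l → r i l) {B g : Matrix (Fin n) (Fin n) ℝ}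
    (hg : IsOrthogonalizer r B g) : IsReduced r (gᵀ * B * g) := by
  refine ⟨fun i => ?_, fun i j hij => ?_⟩
  · rw [transpose_mul_mul_apply]; exact (hg i).norm
  · rw [transpose_mul_mul_apply]
    refine Finset.sum_eq_zero fun l _ => ?_
    by_cases hl : r l j
    · rw [(hg j).ortho l hl, mul_zero]
    · have h1 : l ≠ i := fun h => hl (h ▸ hij)
      have h2 : ¬ r l i := fun h => hl (htrans _ _ _ h hij)
      rw [(hg i).supported l h1 h2, zero_mul]

/-- Once the earlier columns of g are basis vectors, reducedness of gᵀAg says that column j is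
A-orthogonal to the predecessors of j. So is e_j, because A is reduced, and uniqueness of the
orthogonalized column applies. -/
theorem eq_one_of_isReduced {r : Fin n → Fin n → Prop} (hr : ∀ i j, r i j → i < j)
    {A g : Matrix (Fin n) (Fin n) ℝ} (hA : A.PosDef) (hA1 : IsReduced r A)
    (hg : ∀ i j, i ≠ j → ¬ r i j → g i j = 0) (hg0 : ∀ i, 0 ≤ g i i)
    (hgA : IsReduced r (gᵀ * A * g)) : g = 1 := by
  have key : ∀ j, g.col j = Pi.single j 1 := by
    intro j
    induction j using WellFoundedLT.induction with
    | ind j ih =>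
      have h1 : IsOrthoColumn A {l | r l j} j (g.col j) := by
        refine ⟨fun m hm hm' => hg m j hm hm', fun l hl => ?_, ?_, hg0 j⟩
        · have h := hgA.2 l j hl
          rw [transpose_mul_mul_apply, ih l (hr _ _ hl)] at h
          simpa using h
        · rw [← transpose_mul_mul_apply]; exact hgA.1 j
      have h2 : IsOrthoColumn A {l | r l j} j (Pi.single j 1) := by
        refine ⟨fun m hm _ => by simp [hm], fun l hl => ?_, ?_, by simp⟩
        · simpa using hA1.2 l j hl
        · simpa using hA1.1 j
      exact h1.unique hA h2
  ext i j
  have := congrFun (key j) i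
  simpa [Matrix.one_apply, Pi.single_apply] using this

end GramSchmidt

/-! ### Triangular matrices and Cholesky factorization -/

section Cholesky

variable {n : ℕ}

theorem IsPosUpper.isUnit_det {a : Matrix (Fin n) (Fin n) ℝ} (ha : IsPosUpper a) :
    IsUnit a.det := by
  rw [Matrix.det_of_isUpperTriangular ha.1]
  exact (Finset.prod_pos fun i _ => ha.2 i).ne'.isUnit

theorem blockTriangular_mul_diag {a b : Matrix (Fin n) (Fin n) ℝ} (ha : a.BlockTriangular id)
    (hb : b.BlockTriangular id) (i : Fin n) : (a * b) i i = a i i * b i i := by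
  rw [Matrix.mul_apply, Finset.sum_eq_single i]
  · intro l _ hl
    rcases lt_or_gt_of_ne hl with h | h
    · rw [ha h, zero_mul]
    · rw [hb h, mul_zero]
  · simp

theorem IsPosUpper.mul {a b : Matrix (Fin n) (Fin n) ℝ} (ha : IsPosUpper a) (hb : IsPosUpper b) :
    IsPosUpper (a * b) :=
  ⟨ha.1.mul hb.1, fun i => by
    rw [blockTriangular_mul_diag ha.1 hb.1]; exact mul_pos (ha.2 i) (hb.2 i)⟩

theorem IsPosUpper.add {a b : Matrix (Fin n) (Fin n) ℝ} (ha : IsPosUpper a) (hb : IsPosUpper b) :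
    IsPosUpper (a + b) :=
  ⟨ha.1.add hb.1, fun i => add_pos (ha.2 i) (hb.2 i)⟩

theorem IsPosUpper.inv {a : Matrix (Fin n) (Fin n) ℝ} (ha : IsPosUpper a) : IsPosUpper a⁻¹ := by
  have : Invertible a := a.invertibleOfIsUnitDet ha.isUnit_det
  have h : a⁻¹.BlockTriangular id := Matrix.blockTriangular_inv_of_blockTriangular ha.1
  refine ⟨h, fun i => ?_⟩
  have h1 := blockTriangular_mul_diag ha.1 h i
  rw [Matrix.mul_nonsing_inv _ ha.isUnit_det, Matrix.one_apply_eq] at h1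
  exact pos_of_mul_pos_right (h1 ▸ one_pos) (ha.2 i).le

theorem IsPosUpper.smul {a : Matrix (Fin n) (Fin n) ℝ} (ha : IsPosUpper a) {c : ℝ} (hc : 0 < c) :
    IsPosUpper (c • a) :=
  ⟨fun i j h => by simp [ha.1 h], fun i => mul_pos hc (ha.2 i)⟩

theorem posDef_transpose_mul_self {a : Matrix (Fin n) (Fin n) ℝ} (ha : IsUnit a.det) :
    (aᵀ * a).PosDef := by
  have := Matrix.PosDef.conjTranspose_mul_self a
    (Matrix.mulVec_injective_of_isUnit ((Matrix.isUnit_iff_isUnit_det _).2 ha))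
  simpa using this

/-- The quotient ab⁻¹ is orthogonal and upper triangular with nonnegative diagonal, hence 1. Strict
positivity is not asked of a, so that a may be a limit of Cholesky factors. -/
theorem eq_of_transpose_mul_self_eq {a b : Matrix (Fin n) (Fin n) ℝ} (ha : a.BlockTriangular id)
    (ha0 : ∀ i, 0 ≤ a i i) (hb : IsPosUpper b) (h : aᵀ * a = bᵀ * b) : a = b := by
  have hb' := hb.inv
  have h1 : a * b⁻¹ = 1 := by
    have hone : IsReduced (· < ·) (1 : Matrix (Fin n) (Fin n) ℝ) :=
      ⟨fun i => by simp, fun i j hij => Matrix.one_apply_ne (ne_of_lt hij)⟩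
    refine eq_one_of_isReduced (r := (· < ·)) (fun _ _ h => h) Matrix.PosDef.one hone ?_ ?_ ?_
    · intro i j hij hij'
      exact (ha.mul hb'.1) (lt_of_le_of_ne (not_lt.1 hij') hij.symm)
    · intro i
      rw [blockTriangular_mul_diag ha hb'.1]
      exact mul_nonneg (ha0 i) (hb'.2 i).le
    · convert hone using 1
      have : (a * b⁻¹)ᵀ * 1 * (a * b⁻¹) = (b⁻¹)ᵀ * (aᵀ * a) * b⁻¹ := by
        simp only [Matrix.transpose_mul, Matrix.mul_one, Matrix.mul_assoc]
      rw [this, h, Matrix.mul_assoc, Matrix.mul_assoc, Matrix.mul_nonsing_inv _ hb.isUnit_det,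
        Matrix.mul_one, ← Matrix.transpose_mul, Matrix.mul_nonsing_inv _ hb.isUnit_det,
        Matrix.transpose_one]
  calc a = a * b⁻¹ * b := by
        rw [Matrix.mul_assoc, Matrix.nonsing_inv_mul _ hb.isUnit_det, Matrix.mul_one]
    _ = b := by rw [h1, Matrix.one_mul]

theorem IsOrthogonalizer.isPosUpper {r : Fin n → Fin n → Prop} (hr : ∀ i j, r i j → i < j)
    {B g : Matrix (Fin n) (Fin n) ℝ} (hB : B.PosDef) (hg : IsOrthogonalizer r B g) :
    IsPosUpper g :=
  ⟨fun i j hij => (hg j).supported i (ne_of_gt hij) fun h => lt_asymm hij (hr _ _ h),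
    fun i => (hg i).pos hB⟩

/-- For the total order, a reduced symmetric matrix is the identity, so the inverse of the
orthogonalizer is the Cholesky factor. -/
theorem exists_isCholesky {A : Matrix (Fin n) (Fin n) ℝ} (hA : A.PosDef) :
    ∃ a, IsCholesky A a := by
  obtain ⟨g, hg⟩ := exists_isOrthogonalizer (r := (· < ·)) (fun i => lt_irrefl i) hA
  have hgu := hg.isPosUpper (fun _ _ h => h) hA
  have hred := IsOrthogonalizer.isReduced (r := (· < ·)) (fun _ _ _ => lt_trans) hg
  have hsymm : (gᵀ * A * g)ᵀ = gᵀ * A * g := by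
    simp [Matrix.transpose_mul, posDef_transpose_eq hA, Matrix.mul_assoc]
  have hone : gᵀ * A * g = 1 := by
    ext i j
    rcases lt_trichotomy i j with h | h | h
    · rw [hred.2 i j h, Matrix.one_apply_ne h.ne]
    · subst h; rw [hred.1, Matrix.one_apply_eq]
    · rw [← hsymm, Matrix.transpose_apply, hred.2 j i h, Matrix.one_apply_ne h.ne']
  refine ⟨g⁻¹, hgu.inv, ?_⟩
  have h1 : gᵀ * A = g⁻¹ := by
    calc gᵀ * A = gᵀ * A * g * g⁻¹ := by
          rw [Matrix.mul_assoc _ g, Matrix.mul_nonsing_inv _ hgu.isUnit_det, Matrix.mul_one]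
      _ = g⁻¹ := by rw [hone, Matrix.one_mul]
  calc g⁻¹ᵀ * g⁻¹ = g⁻¹ᵀ * (gᵀ * A) := by rw [h1]
    _ = (g * g⁻¹)ᵀ * A := by rw [Matrix.transpose_mul, Matrix.mul_assoc]
    _ = A := by
      rw [Matrix.mul_nonsing_inv _ hgu.isUnit_det, Matrix.transpose_one, Matrix.one_mul]

theorem IsCholesky.unique {A a b : Matrix (Fin n) (Fin n) ℝ} (ha : IsCholesky A a)
    (hb : IsCholesky A b) : a = b :=
  eq_of_transpose_mul_self_eq ha.1.1 (fun i => (ha.1.2 i).le) hb.1 (ha.2.trans hb.2.symm)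

end Cholesky

/-! ### Signed involutions and normalized intertwiners -/

section SignedPerm

variable {n : ℕ} {w : Equiv.Perm (Fin n)} {ε : Fin n → ℤˣ}

theorem sign_mul_self (u : ℤˣ) : ((u : ℤ) : ℝ) * ((u : ℤ) : ℝ) = 1 := by
  rcases Int.units_eq_one_or u with h | h <;> simp [h]

theorem mul_signedPerm_apply (M : Matrix (Fin n) (Fin n) ℝ) (i j : Fin n) :
    (M * signedPerm w ε) i j = M i (w j) * ((ε j : ℤ) : ℝ) := by
  simp [Matrix.mul_apply, signedPerm]

theorem signedPerm_mul_self_apply (i j : Fin n) :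
    (signedPerm w ε * signedPerm w ε) i j =
      if i = w (w j) then ((ε (w j) : ℤ) : ℝ) * ((ε j : ℤ) : ℝ) else 0 := by
  rw [mul_signedPerm_apply]
  simp [signedPerm]

theorem perm_involutive (hinv : signedPerm w ε * signedPerm w ε = 1) (i : Fin n) :
    w (w i) = i := by
  have h := signedPerm_mul_self_apply (w := w) (ε := ε) i i
  rw [hinv, Matrix.one_apply_eq] at h
  by_contra hne
  rw [if_neg fun h => hne h.symm] at h
  exact one_ne_zero h

theorem sign_perm (hinv : signedPerm w ε * signedPerm w ε = 1) (i : Fin n) : ε (w i) = ε i := by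
  have h := signedPerm_mul_self_apply (w := w) (ε := ε) i i
  rw [hinv, Matrix.one_apply_eq, if_pos (perm_involutive hinv i).symm] at h
  rcases Int.units_eq_one_or (ε (w i)) with h1 | h1 <;>
    rcases Int.units_eq_one_or (ε i) with h2 | h2 <;> simp_all <;> norm_num at h

theorem signedPerm_mul_apply (hinv : signedPerm w ε * signedPerm w ε = 1)
    (M : Matrix (Fin n) (Fin n) ℝ) (i j : Fin n) :
    (signedPerm w ε * M) i j = ((ε i : ℤ) : ℝ) * M (w i) j := by
  rw [Matrix.mul_apply, Finset.sum_eq_single (w i)]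
  · simp [signedPerm, perm_involutive hinv, sign_perm hinv]
  · intro b _ hb
    have : i ≠ w b := fun h => hb (by rw [h, perm_involutive hinv])
    simp [signedPerm, this]
  · simp

theorem conj_signedPerm_apply (hinv : signedPerm w ε * signedPerm w ε = 1)
    (M : Matrix (Fin n) (Fin n) ℝ) (i j : Fin n) :
    (signedPerm w ε * M * signedPerm w ε) i j =
      ((ε i : ℤ) : ℝ) * M (w i) (w j) * ((ε j : ℤ) : ℝ) := by
  rw [mul_signedPerm_apply, signedPerm_mul_apply hinv]

theorem signedPerm_transpose (hinv : signedPerm w ε * signedPerm w ε = 1) :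
    (signedPerm w ε)ᵀ = signedPerm w ε := by
  ext i j
  simp only [Matrix.transpose_apply, signedPerm, Matrix.of_apply]
  by_cases h : j = w i
  · subst h; simp [perm_involutive hinv, sign_perm hinv]
  · have : i ≠ w j := fun h' => h (by rw [h', perm_involutive hinv])
    simp [h, this]

theorem signedPerm_inv (hinv : signedPerm w ε * signedPerm w ε = 1) :
    (signedPerm w ε)⁻¹ = signedPerm w ε :=
  Matrix.inv_eq_right_inv hinv

/-- The pairs `i < j` that are not inverted by `w`. -/
def NonInv (w : Equiv.Perm (Fin n)) (i j : Fin n) : Prop := i < j ∧ w i < w j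

theorem NonInv.trans {i j l : Fin n} (h : NonInv w i j) (h' : NonInv w j l) : NonInv w i l :=
  ⟨h.1.trans h'.1, h.2.trans h'.2⟩

theorem mem_normalMatrices_iff (hinv : signedPerm w ε * signedPerm w ε = 1)
    {A : Matrix (Fin n) (Fin n) ℝ} : A ∈ normalMatrices w ε ↔
      A.PosDef ∧ signedPerm w ε * A * signedPerm w ε = A ∧ IsReduced (NonInv w) A := by
  simp only [normalMatrices, Set.mem_ofPred_eq, signedPerm_inv hinv, IsReduced, NonInv, and_imp]

/-- W is a B-isometry permuting the coordinate lines, and the involution w preserves non-inversions,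
so the orthogonality conditions are carried to each other. On the diagonal the two signs cancel. -/
theorem IsOrthogonalizer.conj (hinv : signedPerm w ε * signedPerm w ε = 1)
    {B g : Matrix (Fin n) (Fin n) ℝ} (hB : signedPerm w ε * B * signedPerm w ε = B)
    (hg : IsOrthogonalizer (NonInv w) B g) :
    IsOrthogonalizer (NonInv w) B (signedPerm w ε * g * signedPerm w ε) := by
  have hr : ∀ i j, NonInv w i j → NonInv w (w i) (w j) := fun i j h =>
    ⟨h.2, by simpa only [perm_involutive hinv] using h.1⟩
  have hr' : ∀ i j, NonInv w (w i) (w j) → NonInv w i j := fun i j h => by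
    simpa only [perm_involutive hinv] using hr _ _ h
  have hBW : B * signedPerm w ε = signedPerm w ε * B := by
    calc B * signedPerm w ε = signedPerm w ε * signedPerm w ε * (B * signedPerm w ε) := by
          rw [hinv, Matrix.one_mul]
      _ = signedPerm w ε * (signedPerm w ε * B * signedPerm w ε) := by
          simp only [Matrix.mul_assoc]
      _ = _ := by rw [hB]
  have hBg : B * (signedPerm w ε * g * signedPerm w ε) =
      signedPerm w ε * (B * g) * signedPerm w ε := by
    rw [← Matrix.mul_assoc, ← Matrix.mul_assoc, hBW]
    simp only [Matrix.mul_assoc]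
  have hcol : ∀ (M N : Matrix (Fin n) (Fin n) ℝ) (l j : Fin n),
      (M *ᵥ N.col j) l = (M * N) l j := fun M N l j => by
    simp [Matrix.mul_apply, Matrix.mulVec, dotProduct]
  intro j
  refine ⟨fun m hm hm' => ?_, fun l hl => ?_, ?_, ?_⟩
  · rw [Matrix.col_apply, conj_signedPerm_apply hinv]
    have := (hg (w j)).supported (w m) (fun h => hm (w.injective h)) fun h => hm' (hr' _ _ h)
    rw [Matrix.col_apply] at this
    rw [this]; simp
  · rw [hcol, hBg, conj_signedPerm_apply hinv]
    have := (hg (w j)).ortho (w l) (hr _ _ hl)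
    rw [hcol] at this
    rw [this]; simp
  · rw [← transpose_mul_mul_apply]
    have h1 : (signedPerm w ε * g * signedPerm w ε)ᵀ * B * (signedPerm w ε * g * signedPerm w ε) =
        signedPerm w ε * (gᵀ * B * g) * signedPerm w ε := by
      rw [Matrix.mul_assoc, hBg]
      simp only [Matrix.transpose_mul, signedPerm_transpose hinv]
      calc _ = signedPerm w ε * gᵀ * (signedPerm w ε * signedPerm w ε) * B * g * signedPerm w ε := by
            simp only [Matrix.mul_assoc]
        _ = _ := by rw [hinv]; simp only [Matrix.mul_assoc, Matrix.one_mul]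
    rw [h1, conj_signedPerm_apply hinv, transpose_mul_mul_apply, (hg (w j)).norm, mul_one,
      sign_mul_self]
  · rw [Matrix.col_apply, conj_signedPerm_apply hinv, mul_right_comm, sign_mul_self, one_mul]
    exact (hg (w j)).nonneg

theorem commute_of_conj_eq (hinv : signedPerm w ε * signedPerm w ε = 1)
    {g : Matrix (Fin n) (Fin n) ℝ} (h : signedPerm w ε * g * signedPerm w ε = g) :
    g * signedPerm w ε = signedPerm w ε * g := by
  calc g * signedPerm w ε = signedPerm w ε * g * (signedPerm w ε * signedPerm w ε) := by
        rw [← Matrix.mul_assoc, h]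
    _ = _ := by rw [hinv, Matrix.mul_one]

theorem conj_eq_of_commute (hinv : signedPerm w ε * signedPerm w ε = 1)
    {g : Matrix (Fin n) (Fin n) ℝ} (h : g * signedPerm w ε = signedPerm w ε * g) :
    signedPerm w ε * g * signedPerm w ε = g := by
  rw [Matrix.mul_assoc, h, ← Matrix.mul_assoc, hinv, Matrix.one_mul]

/-- A matrix conjugating `signedPerm w ε` to `a * signedPerm w ε * a⁻¹` is determined by the
normalization of its Gram matrix. -/
theorem eq_of_intertwines (hinv : signedPerm w ε * signedPerm w ε = 1)
    {a b : Matrix (Fin n) (Fin n) ℝ} (ha : IsPosUpper a) (haA : aᵀ * a ∈ normalMatrices w ε)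
    (hb : b.BlockTriangular id) (hb0 : ∀ i, 0 ≤ b i i) (hbr : IsReduced (NonInv w) (bᵀ * b))
    (hab : a * signedPerm w ε * a⁻¹ * b = b * signedPerm w ε) : b = a := by
  obtain ⟨hA, -, hAr⟩ := (mem_normalMatrices_iff hinv).1 haA
  have haa := Matrix.nonsing_inv_mul _ ha.isUnit_det
  have haa' := Matrix.mul_nonsing_inv _ ha.isUnit_det
  have hcomm : (a⁻¹ * b) * signedPerm w ε = signedPerm w ε * (a⁻¹ * b) := by
    calc (a⁻¹ * b) * signedPerm w ε = a⁻¹ * a * signedPerm w ε * a⁻¹ * b := by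
          rw [Matrix.mul_assoc, ← hab]; simp only [Matrix.mul_assoc]
      _ = _ := by rw [haa, Matrix.one_mul, Matrix.mul_assoc]
  have hconj := conj_eq_of_commute hinv hcomm
  have htri : (a⁻¹ * b).BlockTriangular id := ha.inv.1.mul hb
  have h1 : a⁻¹ * b = 1 := by
    refine eq_one_of_isReduced (r := NonInv w) (fun _ _ h => h.1) hA hAr ?_ ?_ ?_
    · intro i j hij hij'
      -- At an inversion, commuting with W equates the entry up to sign with one below the diagonal.
      by_cases h : i < j
      · have hw : w j < w i := lt_of_le_of_ne (not_lt.1 fun h' => hij' ⟨h, h'⟩)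
          fun h' => hij (w.injective h').symm
        rw [← hconj, conj_signedPerm_apply hinv, htri hw]; simp
      · exact htri (lt_of_le_of_ne (not_lt.1 h) hij.symm)
    · intro i
      rw [blockTriangular_mul_diag ha.inv.1 hb]
      exact mul_nonneg (ha.inv.2 i).le (hb0 i)
    · convert hbr using 1
      calc (a⁻¹ * b)ᵀ * (aᵀ * a) * (a⁻¹ * b) = bᵀ * (a * a⁻¹)ᵀ * (a * a⁻¹) * b := by
            simp only [Matrix.transpose_mul, Matrix.mul_assoc]
        _ = bᵀ * b := by rw [haa']; simp
  calc b = a * (a⁻¹ * b) := by rw [← Matrix.mul_assoc, haa', Matrix.one_mul]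
    _ = a := by rw [h1, Matrix.mul_one]

/-- Invariance of aᵀa under W is what makes the conjugate of W orthogonal. -/
theorem conj_mem_bruhatCell {k : ℕ} (hinv : signedPerm w ε * signedPerm w ε = 1)
    (htr : (signedPerm w ε).trace = (n : ℝ) - 2 * (k : ℝ))
    {a : Matrix (Fin n) (Fin n) ℝ} (ha : IsPosUpper a) (haA : aᵀ * a ∈ normalMatrices w ε) :
    a * signedPerm w ε * a⁻¹ ∈ bruhatCell k (signedPerm w ε) := by
  obtain ⟨-, hWA, -⟩ := (mem_normalMatrices_iff hinv).1 haA
  have haa := Matrix.nonsing_inv_mul _ ha.isUnit_det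
  have haa' := Matrix.mul_nonsing_inv _ ha.isUnit_det
  refine ⟨⟨?_, ?_, ?_⟩, ?_⟩
  · rw [Matrix.mem_orthogonalGroup_iff']
    calc (a * signedPerm w ε * a⁻¹)ᵀ * (a * signedPerm w ε * a⁻¹) =
          (a⁻¹)ᵀ * (signedPerm w ε * (aᵀ * a) * signedPerm w ε) * a⁻¹ := by
          simp only [Matrix.transpose_mul, signedPerm_transpose hinv, Matrix.mul_assoc]
      _ = (a * a⁻¹)ᵀ * (a * a⁻¹) := by
          rw [hWA]; simp only [Matrix.transpose_mul, Matrix.mul_assoc]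
      _ = 1 := by rw [haa']; simp
  · calc a * signedPerm w ε * a⁻¹ * (a * signedPerm w ε * a⁻¹) =
          a * signedPerm w ε * (a⁻¹ * a) * signedPerm w ε * a⁻¹ := by
          simp only [Matrix.mul_assoc]
      _ = a * (signedPerm w ε * signedPerm w ε) * a⁻¹ := by
          rw [haa]; simp only [Matrix.mul_assoc, Matrix.one_mul]
      _ = 1 := by rw [hinv, Matrix.mul_one, haa']
  · rw [Matrix.trace_mul_comm, ← Matrix.mul_assoc, haa, Matrix.one_mul, htr]
  · have hdet : 0 < a.det := by
      rw [Matrix.det_of_isUpperTriangular ha.1]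
      exact Finset.prod_pos fun i _ => ha.2 i
    rcases Nat.eq_zero_or_pos n with hn | hn
    · subst hn
      exact ⟨a, ⟨ha, by simp⟩, a⁻¹, ⟨ha.inv, by simp⟩, rfl⟩
    -- Scaling a does not change the conjugate; this factor makes the determinant 1. The exponent is
    -- why n = 0 is treated apart.
    · set c : ℝ := a.det ^ (-(1 / (n : ℝ))) with hc
      have hc0 : 0 < c := Real.rpow_pos_of_pos hdet _
      have hcn : c ^ n * a.det = 1 := by
        rw [hc, ← Real.rpow_natCast, ← Real.rpow_mul hdet.le]
        have : -(1 / (n : ℝ)) * n = -1 := by field_simp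
        rw [this, Real.rpow_neg_one, inv_mul_cancel₀ hdet.ne']
      refine ⟨c • a, ⟨ha.smul hc0, by simpa [Matrix.det_smul] using hcn⟩,
        c⁻¹ • a⁻¹, ⟨ha.inv.smul (inv_pos.2 hc0), ?_⟩, ?_⟩
      · rw [Matrix.det_smul, Fintype.card_fin, Matrix.det_nonsing_inv, Ring.inverse_eq_inv',
          inv_pow, ← mul_inv, hcn, inv_one]
      · simp [smul_smul, hc0.ne']

/-- Every element of the Bruhat cell arises from a normalized Gram matrix. -/
theorem exists_of_mem_bruhatCell {k : ℕ} (hinv : signedPerm w ε * signedPerm w ε = 1)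
    {g : Matrix (Fin n) (Fin n) ℝ} (hg : g ∈ bruhatCell k (signedPerm w ε)) :
    ∃ a, IsPosUpper a ∧ aᵀ * a ∈ normalMatrices w ε ∧ g = a * signedPerm w ε * a⁻¹ := by
  obtain ⟨⟨hO, hgg, -⟩, b, ⟨hb, -⟩, c, ⟨hc, -⟩, hgbc⟩ := hg
  have hcc := Matrix.mul_nonsing_inv _ hc.isUnit_det
  set W := signedPerm w ε with hW
  have hd : IsPosUpper (b + c⁻¹) := hb.add hc.inv
  have h1 : g * c⁻¹ = b * W := by rw [hgbc, Matrix.mul_assoc, hcc, Matrix.mul_one]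
  have h2 : g * b = c⁻¹ * W := by
    calc g * b = g * (b * W) * W := by
          rw [Matrix.mul_assoc, Matrix.mul_assoc, hinv, Matrix.mul_one]
      _ = c⁻¹ * W := by rw [← h1, ← Matrix.mul_assoc, hgg, Matrix.one_mul]
  have h3 : g * (b + c⁻¹) = (b + c⁻¹) * W := by
    rw [Matrix.mul_add, Matrix.add_mul, h1, h2, add_comm]
  set d := b + c⁻¹
  have hgT : gᵀ * g = 1 := (Matrix.mem_orthogonalGroup_iff' _ _).1 hO
  have hB := posDef_transpose_mul_self hd.isUnit_det
  have hBW : W * (dᵀ * d) * W = dᵀ * d := by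
    calc W * (dᵀ * d) * W = (d * W)ᵀ * (d * W) := by
          rw [Matrix.transpose_mul, hW, signedPerm_transpose hinv]; simp only [Matrix.mul_assoc]
      _ = dᵀ * (gᵀ * g) * d := by
          rw [← h3, Matrix.transpose_mul]; simp only [Matrix.mul_assoc]
      _ = dᵀ * d := by rw [hgT, Matrix.mul_one]
  obtain ⟨γ, hγ⟩ := exists_isOrthogonalizer (r := NonInv w) (fun i h => lt_irrefl i h.1) hB
  have hγu := hγ.isPosUpper (fun _ _ h => h.1) hB
  -- Uniqueness of the orthogonalizer turns equivariance into commutation with W.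
  have hγW : W * γ * W = γ := (hγ.conj hinv hBW).unique hB hγ
  have hcomm : γ * W = W * γ := commute_of_conj_eq hinv hγW
  have hu := hd.mul hγu
  have hgram : (d * γ)ᵀ * (d * γ) = γᵀ * (dᵀ * d) * γ := by
    simp only [Matrix.transpose_mul, Matrix.mul_assoc]
  refine ⟨d * γ, hu, (mem_normalMatrices_iff hinv).2
    ⟨posDef_transpose_mul_self hu.isUnit_det, ?_, ?_⟩, ?_⟩
  · have hcommT : W * γᵀ = γᵀ * W := by
      have := congrArg Matrix.transpose hcomm
      simpa [Matrix.transpose_mul, hW, signedPerm_transpose hinv] using this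
    rw [hgram]
    calc W * (γᵀ * (dᵀ * d) * γ) * W = (W * γᵀ) * (dᵀ * d) * (γ * W) := by
          simp only [Matrix.mul_assoc]
      _ = γᵀ * (W * (dᵀ * d) * W) * γ := by
          rw [hcomm, hcommT]; simp only [Matrix.mul_assoc]
      _ = _ := by rw [hBW]
  · rw [hgram]; exact hγ.isReduced fun _ _ _ h h' => h.trans h'
  · calc g = g * (d * γ * (d * γ)⁻¹) := by
          rw [Matrix.mul_nonsing_inv _ hu.isUnit_det, Matrix.mul_one]
      _ = g * d * γ * (d * γ)⁻¹ := by simp only [Matrix.mul_assoc]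
      _ = d * γ * W * (d * γ)⁻¹ := by
          rw [h3, Matrix.mul_assoc d W, ← hcomm]
          simp only [Matrix.mul_assoc]

end SignedPerm

/-! ### Continuity by compactness, and the homeomorphism -/

section Homeomorphism

variable {n : ℕ} {w : Equiv.Perm (Fin n)} {ε : Fin n → ℤˣ}

theorem isCompact_entries_le_one :
    IsCompact {a : Matrix (Fin n) (Fin n) ℝ | ∀ i j, a i j ∈ Set.Icc (-1 : ℝ) 1} := by
  have : {a : Matrix (Fin n) (Fin n) ℝ | ∀ i j, a i j ∈ Set.Icc (-1 : ℝ) 1} =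
      Set.pi Set.univ fun _ => Set.pi Set.univ fun _ => Set.Icc (-1 : ℝ) 1 := by
    ext a
    exact ⟨fun h i _ j _ => h i j, fun h i j => h i trivial j trivial⟩
  rw [this]
  exact isCompact_univ_pi fun _ => isCompact_univ_pi fun _ => isCompact_Icc

/-- A matrix-valued map with bounded entries is continuous if its values are the only possible
limits along ultrafilters. -/
theorem continuous_of_ultrafilter_limits {X : Type*} [TopologicalSpace X]
    (f : X → Matrix (Fin n) (Fin n) ℝ) (hf : ∀ x i j, f x i j ∈ Set.Icc (-1 : ℝ) 1)
    (h : ∀ x (u : Ultrafilter X) a, (u : Filter X) ≤ 𝓝 x → Tendsto f u (𝓝 a) → a = f x) :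
    Continuous f := by
  rw [continuous_iff_continuousAt]
  intro x
  rw [ContinuousAt, tendsto_iff_ultrafilter]
  intro u hu
  obtain ⟨a, -, ha⟩ := isCompact_entries_le_one.ultrafilter_le_nhds (u.map f)
    (le_principal_iff.2 (Filter.mem_map.2 (Filter.univ_mem' fun x => hf x)))
  rw [← h x u a hu ha]
  exact ha

/-- The columns of a are unit vectors. -/
theorem entries_mem_Icc_of_gram_diag {a : Matrix (Fin n) (Fin n) ℝ}
    (h : ∀ j, (aᵀ * a) j j = 1) (i j : Fin n) : a i j ∈ Set.Icc (-1 : ℝ) 1 := by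
  have h1 := h j
  rw [Matrix.mul_apply] at h1
  have h2 : a i j * a i j ≤ 1 := by
    rw [← h1]
    exact Finset.single_le_sum (f := fun l => aᵀ j l * a l j)
      (fun l _ => mul_self_nonneg (a l j)) (Finset.mem_univ i)
  exact abs_le.1 (abs_le_one_iff_mul_self_le_one.2 h2)

theorem tendsto_entry {X : Type*} {l : Filter X} {f : X → Matrix (Fin n) (Fin n) ℝ}
    {a : Matrix (Fin n) (Fin n) ℝ} (h : Tendsto f l (𝓝 a)) (i j : Fin n) :
    Tendsto (fun x => f x i j) l (𝓝 (a i j)) :=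
  (continuous_id.matrix_elem i j).continuousAt.tendsto.comp h

theorem blockTriangular_of_tendsto {X : Type*} {l : Filter X} [l.NeBot]
    {f : X → Matrix (Fin n) (Fin n) ℝ} {a : Matrix (Fin n) (Fin n) ℝ} (h : Tendsto f l (𝓝 a))
    (hf : ∀ x, IsPosUpper (f x)) : a.BlockTriangular id := fun i j hij =>
  tendsto_nhds_unique (tendsto_entry h i j)
    (by simpa only [(hf _).1 hij] using tendsto_const_nhds)

theorem diag_nonneg_of_tendsto {X : Type*} {l : Filter X} [l.NeBot]
    {f : X → Matrix (Fin n) (Fin n) ℝ} {a : Matrix (Fin n) (Fin n) ℝ} (h : Tendsto f l (𝓝 a))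
    (hf : ∀ x, IsPosUpper (f x)) (i : Fin n) : 0 ≤ a i i :=
  ge_of_tendsto' (tendsto_entry h i i) fun x => ((hf x).2 i).le

theorem tendsto_gram {X : Type*} {l : Filter X} {f : X → Matrix (Fin n) (Fin n) ℝ}
    {a : Matrix (Fin n) (Fin n) ℝ} (h : Tendsto f l (𝓝 a)) :
    Tendsto (fun x => (f x)ᵀ * f x) l (𝓝 (aᵀ * a)) :=
  ((continuous_id.matrix_transpose.matrix_mul continuous_id).tendsto a).comp h

theorem isReduced_of_tendsto {X : Type*} {l : Filter X} [l.NeBot] {r : Fin n → Fin n → Prop}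
    {f : X → Matrix (Fin n) (Fin n) ℝ} {a : Matrix (Fin n) (Fin n) ℝ} (h : Tendsto f l (𝓝 a))
    (hf : ∀ x, IsReduced r (f x)) : IsReduced r a :=
  ⟨fun i => tendsto_nhds_unique (tendsto_entry h i i)
      (by simpa only [(hf _).1 i] using tendsto_const_nhds),
    fun i j hij => tendsto_nhds_unique (tendsto_entry h i j)
      (by simpa only [(hf _).2 i j hij] using tendsto_const_nhds)⟩

theorem continuous_of_isCholesky {S : Set (Matrix (Fin n) (Fin n) ℝ)}
    (hS : ∀ A ∈ S, ∀ i, A i i = 1) (f : S → Matrix (Fin n) (Fin n) ℝ)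
    (hf : ∀ A : S, IsCholesky (A : Matrix (Fin n) (Fin n) ℝ) (f A)) : Continuous f := by
  refine continuous_of_ultrafilter_limits f (fun A => entries_mem_Icc_of_gram_diag fun j => ?_)
    fun A u a hu ha => ?_
  · rw [(hf A).2]; exact hS A A.2 j
  · refine eq_of_transpose_mul_self_eq (blockTriangular_of_tendsto ha fun x => (hf x).1)
      (diag_nonneg_of_tendsto ha fun x => (hf x).1) (hf A).1 ?_
    have h1 := tendsto_gram ha
    simp only [(hf _).2] at h1 ⊢
    exact tendsto_nhds_unique h1 ((continuous_subtype_val.tendsto A).mono_left hu)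

/-- The relation passes to the limit in the form g f(g) = f(g) W, free of inverses, since a limit of
the f(g) might a priori be singular. -/
theorem continuous_of_isIntertwiner {k : ℕ} (hinv : signedPerm w ε * signedPerm w ε = 1)
    (f : bruhatCell k (signedPerm w ε) → Matrix (Fin n) (Fin n) ℝ)
    (hf : ∀ g, IsPosUpper (f g) ∧ (f g)ᵀ * f g ∈ normalMatrices w ε ∧
      (g : Matrix (Fin n) (Fin n) ℝ) = f g * signedPerm w ε * (f g)⁻¹) : Continuous f := by
  have hred : ∀ g, IsReduced (NonInv w) ((f g)ᵀ * f g) := fun g =>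
    ((mem_normalMatrices_iff hinv).1 (hf g).2.1).2.2
  refine continuous_of_ultrafilter_limits f (fun g => entries_mem_Icc_of_gram_diag (hred g).1)
    fun g u a hu ha => ?_
  refine eq_of_intertwines hinv (hf g).1 (hf g).2.1
    (blockTriangular_of_tendsto ha fun x => (hf x).1)
    (diag_nonneg_of_tendsto ha fun x => (hf x).1) (isReduced_of_tendsto (tendsto_gram ha) hred) ?_
  rw [← (hf g).2.2]
  have hmul : ∀ x : bruhatCell k (signedPerm w ε),
      (x : Matrix (Fin n) (Fin n) ℝ) * f x = f x * signedPerm w ε := fun x => by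
    conv_lhs => rw [(hf x).2.2]
    rw [Matrix.mul_assoc, Matrix.nonsing_inv_mul _ (hf x).1.isUnit_det, Matrix.mul_one]
  have h1 : Tendsto (fun x : bruhatCell k (signedPerm w ε) =>
      (x : Matrix (Fin n) (Fin n) ℝ) * f x) u (𝓝 (g * a)) :=
    ((continuous_fst.matrix_mul continuous_snd).tendsto
      ((g : Matrix (Fin n) (Fin n) ℝ), a)).comp
      (((continuous_subtype_val.tendsto g).mono_left hu).prodMk_nhds ha)
  have h2 : Tendsto (fun x => f x * signedPerm w ε) u (𝓝 (a * signedPerm w ε)) :=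
    ((continuous_id.matrix_mul continuous_const).tendsto a).comp ha
  simp only [hmul] at h1
  exact tendsto_nhds_unique h1 h2

/-- The homeomorphism from normalized matrices to the Bruhat cell given by Cholesky
factorization. -/
theorem exists_homeomorph_bruhatCell {k : ℕ} (hinv : signedPerm w ε * signedPerm w ε = 1)
    (htr : (signedPerm w ε).trace = (n : ℝ) - 2 * (k : ℝ)) :
    ∃ Φ : normalMatrices w ε ≃ₜ bruhatCell k (signedPerm w ε),
      ∀ (A : normalMatrices w ε) (a : Matrix (Fin n) (Fin n) ℝ),
        IsCholesky (A : Matrix (Fin n) (Fin n) ℝ) a →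
          (Φ A : Matrix (Fin n) (Fin n) ℝ) = a * signedPerm w ε * a⁻¹ := by
  choose c hc using fun A : normalMatrices w ε => exists_isCholesky A.2.1
  choose f hf using fun g : bruhatCell k (signedPerm w ε) => exists_of_mem_bruhatCell hinv g.2
  have hcA : ∀ A, (c A)ᵀ * c A ∈ normalMatrices w ε := fun A => by rw [(hc A).2]; exact A.2
  have hcc : Continuous c := continuous_of_isCholesky (fun A hA => hA.2.2.1) c hc
  have hfc : Continuous f := continuous_of_isIntertwiner hinv f hf
  have hcinv : Continuous fun A => (c A)⁻¹ := by
    refine continuous_iff_continuousAt.2 fun A => ?_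
    refine ContinuousAt.comp (g := fun M : Matrix (Fin n) (Fin n) ℝ => M⁻¹)
      (continuousAt_matrix_inv _ ?_) hcc.continuousAt
    rw [Ring.inverse_eq_inv']
    exact continuousAt_inv₀ (hc A).1.isUnit_det.ne_zero
  refine ⟨{
    toFun := fun A => ⟨c A * signedPerm w ε * (c A)⁻¹,
      conj_mem_bruhatCell hinv htr (hc A).1 (hcA A)⟩
    invFun := fun g => ⟨(f g)ᵀ * f g, (hf g).2.1⟩
    left_inv := fun A => ?_
    right_inv := fun g => ?_
    continuous_toFun := ((hcc.matrix_mul continuous_const).matrix_mul hcinv).subtype_mk _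
    continuous_invFun := (hfc.matrix_transpose.matrix_mul hfc).subtype_mk _ }, fun A a ha => ?_⟩
  · apply Subtype.ext
    set g : bruhatCell k (signedPerm w ε) := ⟨c A * signedPerm w ε * (c A)⁻¹,
      conj_mem_bruhatCell hinv htr (hc A).1 (hcA A)⟩ with hg
    have : f g = c A := by
      refine eq_of_intertwines hinv (hc A).1 (hcA A) (hf g).1.1 (fun i => ((hf g).1.2 i).le)
        ((mem_normalMatrices_iff hinv).1 (hf g).2.1).2.2 ?_
      have h := (hf g).2.2
      change c A * signedPerm w ε * (c A)⁻¹ = _ at h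
      rw [h, Matrix.mul_assoc, Matrix.nonsing_inv_mul _ (hf g).1.isUnit_det, Matrix.mul_one]
    change (f g)ᵀ * f g = A
    rw [this, (hc A).2]
  · apply Subtype.ext
    have : c ⟨(f g)ᵀ * f g, (hf g).2.1⟩ = f g := (hc _).unique ⟨(hf g).1, rfl⟩
    change c ⟨(f g)ᵀ * f g, (hf g).2.1⟩ * _ * (c ⟨(f g)ᵀ * f g, (hf g).2.1⟩)⁻¹ = g
    rw [this, ← (hf g).2.2]
  · change c A * signedPerm w ε * (c A)⁻¹ = _
    rw [(hc A).unique ha]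

end Homeomorphism

/-! ### Affine span, convexity and openness of the normal matrices -/

section Tangent

variable {n : ℕ} {w : Equiv.Perm (Fin n)} {ε : Fin n → ℤˣ}

/-- The direction of the affine span of `normalMatrices w ε`. -/
def tangentSpace (w : Equiv.Perm (Fin n)) (ε : Fin n → ℤˣ) :
    Submodule ℝ (Matrix (Fin n) (Fin n) ℝ) where
  carrier := {M | Mᵀ = M ∧ signedPerm w ε * M * signedPerm w ε = M ∧ (∀ i, M i i = 0) ∧
    ∀ i j, NonInv w i j → M i j = 0}
  zero_mem' := by simp
  add_mem' := by
    rintro M N ⟨h1, h2, h3, h4⟩ ⟨h1', h2', h3', h4'⟩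
    refine ⟨by rw [Matrix.transpose_add, h1, h1'], by rw [Matrix.mul_add, Matrix.add_mul, h2, h2'],
      fun i => by simp [h3, h3'], fun i j h => by simp [h4 i j h, h4' i j h]⟩
  smul_mem' := by
    rintro c M ⟨h1, h2, h3, h4⟩
    refine ⟨by rw [Matrix.transpose_smul, h1], by rw [Matrix.mul_smul, Matrix.smul_mul, h2],
      fun i => by simp [h3], fun i j h => by simp [h4 i j h]⟩

theorem mem_normalMatrices_iff_sub_one_mem (hinv : signedPerm w ε * signedPerm w ε = 1)
    {A : Matrix (Fin n) (Fin n) ℝ} :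
    A ∈ normalMatrices w ε ↔ A - 1 ∈ tangentSpace w ε ∧ A.PosDef := by
  have hW : signedPerm w ε * (A - 1) * signedPerm w ε = A - 1 ↔
      signedPerm w ε * A * signedPerm w ε = A := by
    rw [Matrix.mul_sub, Matrix.sub_mul, Matrix.mul_one, hinv, sub_left_inj]
  have hd : (∀ i, (A - 1) i i = 0) ↔ ∀ i, A i i = 1 := by simp [sub_eq_zero]
  have hn : (∀ i j, NonInv w i j → (A - 1) i j = 0) ↔ ∀ i j, NonInv w i j → A i j = 0 := by
    refine forall₃_congr fun i j h => ?_
    rw [Matrix.sub_apply, Matrix.one_apply_ne h.1.ne, sub_zero]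
  rw [mem_normalMatrices_iff hinv]
  change _ ↔ (_ ∧ _ ∧ _ ∧ _) ∧ _
  rw [hW, hd, hn]
  constructor
  · rintro ⟨h1, h2, h3, h4⟩
    exact ⟨⟨by rw [Matrix.transpose_sub, posDef_transpose_eq h1, Matrix.transpose_one],
      h2, h3, h4⟩, h1⟩
  · rintro ⟨⟨-, h2, h3, h4⟩, h1⟩
    exact ⟨h1, h2, h3, h4⟩

theorem one_mem_normalMatrices (hinv : signedPerm w ε * signedPerm w ε = 1) :
    (1 : Matrix (Fin n) (Fin n) ℝ) ∈ normalMatrices w ε :=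
  (mem_normalMatrices_iff_sub_one_mem hinv).2 ⟨by simp, Matrix.PosDef.one⟩

theorem convex_normalMatrices : Convex ℝ (normalMatrices w ε) := by
  rintro A ⟨h1, h2, h3, h4⟩ B ⟨h1', h2', h3', h4'⟩ a b ha hb hab
  refine ⟨?_, ?_, fun i => by simp [h3, h3', hab],
    fun i j h h' => by simp [h4 i j h h', h4' i j h h']⟩
  · rcases ha.eq_or_lt with rfl | ha
    · have : b = 1 := by linarith
      subst this; simpa using h1'
    · rcases hb.eq_or_lt with rfl | hb
      · have : a = 1 := by linarith
        subst this; simpa using h1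
      · exact (h1.smul ha).add (h1'.smul hb)
  · simp only [Matrix.mul_add, Matrix.add_mul, Matrix.mul_smul, Matrix.smul_mul, h2, h2']

/-- Compactness of the sphere lets positivity at each vector persist uniformly near A. -/
theorem isOpen_pos_quadratic : IsOpen {A : Matrix (Fin n) (Fin n) ℝ |
    ∀ x ∈ Metric.sphere (0 : Fin n → ℝ) 1, 0 < x ⬝ᵥ (A *ᵥ x)} := by
  rw [isOpen_iff_mem_nhds]
  intro A hA
  refine (isCompact_sphere (0 : Fin n → ℝ) 1).eventually_forall_of_forall_eventually
    fun x hx => ?_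
  have hc : Continuous fun z : Matrix (Fin n) (Fin n) ℝ × (Fin n → ℝ) =>
      z.2 ⬝ᵥ (z.1 *ᵥ z.2) :=
    continuous_snd.dotProduct (continuous_fst.matrix_mulVec continuous_snd)
  exact hc.continuousAt.eventually (lt_mem_nhds (hA x hx))

theorem posDef_iff_pos_on_sphere {A : Matrix (Fin n) (Fin n) ℝ} (hA : Aᵀ = A) :
    A.PosDef ↔ ∀ x ∈ Metric.sphere (0 : Fin n → ℝ) 1, 0 < x ⬝ᵥ (A *ᵥ x) := by
  refine ⟨fun h x hx => posDef_dotProduct_pos h fun h0 => by simp [h0] at hx, fun h => ?_⟩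
  refine Matrix.PosDef.of_dotProduct_mulVec_pos (by simpa [Matrix.IsHermitian] using hA)
    fun x hx => ?_
  have hx0 : 0 < ‖x‖ := norm_pos_iff.2 hx
  have h1 := h (‖x‖⁻¹ • x) (by simp [norm_smul, hx0.ne'])
  simp only [Matrix.mulVec_smul, smul_dotProduct, dotProduct_smul, smul_eq_mul] at h1
  simpa using pos_of_mul_pos_right (pos_of_mul_pos_right h1 (inv_pos.2 hx0).le) (inv_pos.2 hx0).le

theorem mem_normalMatrices_iff_pos_on_sphere (hinv : signedPerm w ε * signedPerm w ε = 1)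
    {A : Matrix (Fin n) (Fin n) ℝ} (hA : A - 1 ∈ tangentSpace w ε) :
    A ∈ normalMatrices w ε ↔
      A ∈ {A | ∀ x ∈ Metric.sphere (0 : Fin n → ℝ) 1, 0 < x ⬝ᵥ (A *ᵥ x)} := by
  have h1 : Aᵀ = A := by
    have := hA.1
    rwa [Matrix.transpose_sub, Matrix.transpose_one, sub_left_inj] at this
  rw [mem_normalMatrices_iff_sub_one_mem hinv, posDef_iff_pos_on_sphere h1]
  exact and_iff_right hA

/-- The identity is normal and positivity is open, so 1 + tv stays normal for small t whenever v is
tangent. -/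
theorem vectorSpan_normalMatrices (hinv : signedPerm w ε * signedPerm w ε = 1) :
    vectorSpan ℝ (normalMatrices w ε) = tangentSpace w ε := by
  have h1 := one_mem_normalMatrices hinv
  apply le_antisymm
  · rw [vectorSpan_def, Submodule.span_le]
    rintro _ ⟨A, hA, B, hB, rfl⟩
    have := (tangentSpace w ε).sub_mem ((mem_normalMatrices_iff_sub_one_mem hinv).1 hA).1
      ((mem_normalMatrices_iff_sub_one_mem hinv).1 hB).1
    simpa using this
  · intro v hv
    have hc : Continuous fun t : ℝ => (1 : Matrix (Fin n) (Fin n) ℝ) + t • v := by fun_prop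
    have hmem : ∀ t : ℝ, (1 + t • v) - 1 ∈ tangentSpace w ε := fun t => by
      simpa using (tangentSpace w ε).smul_mem t hv
    have h0 : ∀ᶠ t in 𝓝 (0 : ℝ), 1 + t • v ∈ normalMatrices w ε := by
      have := (isOpen_pos_quadratic.preimage hc).mem_nhds (x := 0)
        ((mem_normalMatrices_iff_pos_on_sphere hinv (hmem 0)).1 (by simpa using h1))
      filter_upwards [this] with t ht
      exact (mem_normalMatrices_iff_pos_on_sphere hinv (hmem t)).2 ht
    obtain ⟨t, ht, ht0⟩ := ((h0.filter_mono nhdsWithin_le_nhds).and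
      (self_mem_nhdsWithin : Set.Ioi (0 : ℝ) ∈ 𝓝[>] 0)).exists
    have ht0' : t ≠ 0 := ne_of_gt ht0
    have h2 := vsub_mem_vectorSpan ℝ ht h1
    simp only [vsub_eq_sub, add_sub_cancel_left] at h2
    simpa [smul_smul, ht0'] using (vectorSpan ℝ (normalMatrices w ε)).smul_mem t⁻¹ h2

theorem isOpen_normalMatrices (hinv : signedPerm w ε * signedPerm w ε = 1) :
    IsOpen {x : affineSpan ℝ (normalMatrices w ε) |
      (x : Matrix (Fin n) (Fin n) ℝ) ∈ normalMatrices w ε} := by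
  convert isOpen_pos_quadratic.preimage
    (continuous_subtype_val (p := (· ∈ affineSpan ℝ (normalMatrices w ε)))) using 1
  ext x
  refine mem_normalMatrices_iff_pos_on_sphere hinv ?_
  have := AffineSubspace.vsub_mem_direction x.2
    (subset_affineSpan ℝ _ (one_mem_normalMatrices hinv))
  rwa [direction_affineSpan, vectorSpan_normalMatrices hinv] at this

/-- Positivity is tested on e_i ± e_j. -/
theorem abs_entry_le_one {A : Matrix (Fin n) (Fin n) ℝ} (hA : A.PosDef) (hd : ∀ i, A i i = 1)
    (i j : Fin n) : |A i j| ≤ 1 := by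
  have hs : A j i = A i j := congrFun (congrFun (posDef_transpose_eq hA) i) j
  have h : ∀ c : ℝ, 0 ≤ 1 + 2 * c * A i j + c * c := fun c => by
    have := hA.posSemidef.dotProduct_mulVec_nonneg (Pi.single i 1 + c • Pi.single j 1)
    simp [Matrix.mulVec_add, Matrix.mulVec_smul, hd, hs] at this
    linarith
  rw [abs_le]
  constructor <;> linarith [h 1, h (-1)]

end Tangent

/-! ### Coordinates on the tangent space and the ball -/

section Dimension

variable {n : ℕ} {w : Equiv.Perm (Fin n)} {ε : Fin n → ℤˣ}

instance : Finite (Inversions w) := inferInstanceAs (Finite (Subtype _))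

instance : Finite (InversionClasses w) := inferInstanceAs (Finite (Quot _))

/-- The entries at representatives of the classes of inversions. -/
noncomputable def tangentCoords (w : Equiv.Perm (Fin n)) (ε : Fin n → ℤˣ) :
    tangentSpace w ε →ₗ[ℝ] (InversionClasses w → ℝ) where
  toFun M q := (M : Matrix (Fin n) (Fin n) ℝ) (Quot.out q).1.1 (Quot.out q).1.2
  map_add' _ _ := rfl
  map_smul' _ _ := rfl

/-- Symmetry and W-invariance give M(w j, w i) = ±M(i, j), so vanishing at an inversion depends only
on its class. -/
theorem tangentCoords_injective (hinv : signedPerm w ε * signedPerm w ε = 1) :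
    Function.Injective (tangentCoords w ε) := by
  rw [injective_iff_map_eq_zero]
  rintro ⟨M, h1, h2, h3, h4⟩ h0
  have hs : ∀ i j, M j i = M i j := fun i j => congrFun (congrFun h1 i) j
  have hp : ∀ p : Inversions w, M p.1.1 p.1.2 = 0 := by
    intro p
    let P : InversionClasses w → Prop := Quot.lift (fun p => M p.1.1 p.1.2 = 0) (by
      intro p q hpq
      have h := conj_signedPerm_apply hinv M p.1.1 p.1.2
      rw [h2] at h
      rw [hpq, h, hs (w p.1.1)]
      rcases Int.units_eq_one_or (ε p.1.1) with h | h <;>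
        rcases Int.units_eq_one_or (ε p.1.2) with h' | h' <;> simp [h, h'])
    have h : P (Quot.mk _ (Quot.out (Quot.mk _ p : InversionClasses w))) :=
      congrFun h0 (Quot.mk _ p)
    rw [Quot.out_eq] at h
    exact h
  have hlt : ∀ i j, i < j → M i j = 0 := fun i j hij => by
    rcases lt_trichotomy (w i) (w j) with h | h | h
    · exact h4 i j ⟨hij, h⟩
    · exact absurd (w.injective h) hij.ne
    · exact hp ⟨(i, j), hij, h⟩
  apply Subtype.ext
  ext i j
  rcases lt_trichotomy i j with h | h | h
  · exact hlt i j h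
  · rw [h]; exact h3 j
  · exact (hs j i).trans (hlt j i h)

theorem tangentCoords_surjective (hinv : signedPerm w ε * signedPerm w ε = 1) :
    Function.Surjective (tangentCoords w ε) := by
  classical
  intro c
  -- Prescribed values are placed at the representatives, then averaged over transposition and
  -- conjugation by W. A pair with i = w j is its own partner and gets counted twice, hence the 1/2.
  let N : Matrix (Fin n) (Fin n) ℝ := Matrix.of fun i j =>
    if h : i < j ∧ w j < w i then
      if Quot.out (Quot.mk _ ⟨(i, j), h⟩ : InversionClasses w) = ⟨(i, j), h⟩ then
        c (Quot.mk _ ⟨(i, j), h⟩) * if i = w j then 1 / 2 else 1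
      else 0
    else 0
  have hN : ∀ i j, ¬ (i < j ∧ w j < w i) → N i j = 0 := fun i j h => by simp [N, h]
  have hN' : ∀ i j, ¬ (i < j ∧ w j < w i) → N (w j) (w i) = 0 := fun i j h => by
    apply hN
    rw [perm_involutive hinv, perm_involutive hinv]
    exact fun h' => h h'.symm
  let T : Matrix (Fin n) (Fin n) ℝ := N + Nᵀ
  have hT : Tᵀ = T := by simp [T, add_comm]
  have hentry : ∀ i j, (T + signedPerm w ε * T * signedPerm w ε) i j = (N i j + N j i) +
      ((ε i : ℤ) : ℝ) * (N (w i) (w j) + N (w j) (w i)) * ((ε j : ℤ) : ℝ) := fun i j => by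
    rw [Matrix.add_apply, conj_signedPerm_apply hinv]
    rfl
  refine ⟨⟨T + signedPerm w ε * T * signedPerm w ε, ?_, ?_, fun i => ?_, fun i j h => ?_⟩, ?_⟩
  · simp only [Matrix.transpose_add, Matrix.transpose_mul, signedPerm_transpose hinv, hT,
      Matrix.mul_assoc]
  · rw [Matrix.mul_add, Matrix.add_mul, add_comm]
    congr 1
    calc _ = (signedPerm w ε * signedPerm w ε) * T * (signedPerm w ε * signedPerm w ε) := by
          simp only [Matrix.mul_assoc]
      _ = T := by rw [hinv, Matrix.one_mul, Matrix.mul_one]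
  · rw [hentry, hN i i (by simp), hN' i i (by simp)]; simp
  · have h1 : ¬ (i < j ∧ w j < w i) := fun h' => lt_asymm h.2 h'.2
    have h2 : ¬ (j < i ∧ w i < w j) := fun h' => lt_asymm h.1 h'.1
    rw [hentry, hN i j h1, hN j i h2, hN' i j h1, hN' j i h2]; simp
  · funext q
    obtain ⟨p, hp⟩ : ∃ p, Quot.out q = p := ⟨_, rfl⟩
    have hq : q = Quot.mk _ p := hp ▸ (Quot.out_eq q).symm
    obtain ⟨⟨i, j⟩, hij⟩ := p
    change (T + signedPerm w ε * T * signedPerm w ε) (Quot.out q).1.1 (Quot.out q).1.2 = c q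
    rw [hp]
    simp only
    have h2 : ¬ (j < i ∧ w i < w j) := fun h' => lt_asymm hij.1 h'.1
    have hNij : N i j = c q * if i = w j then 1 / 2 else 1 := by
      rw [hq] at hp
      simp only [N, Matrix.of_apply]
      rw [dif_pos hij, if_pos hp, hq]
    rw [hentry, hN j i h2, hN' j i h2]
    by_cases hfix : i = w j
    · have hj : w i = j := by rw [hfix, perm_involutive hinv]
      -- Equal signs make the two contributions add rather than cancel.
      have hε : ε i = ε j := by rw [hfix, sign_perm hinv]
      rw [← hfix, hj, hNij, if_pos hfix, hε, zero_add, mul_right_comm, sign_mul_self]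
      ring
    · have hij' : w j < w i ∧ w (w i) < w (w j) := by
        rw [perm_involutive hinv, perm_involutive hinv]; exact hij.symm
      have hmk : (Quot.mk _ ⟨(w j, w i), hij'⟩ : InversionClasses w) = q := by
        rw [hq]
        exact (Quot.sound (r := fun p q : Inversions w => q.1 = (w p.1.2, w p.1.1))
          (a := ⟨(i, j), hij⟩) (b := ⟨(w j, w i), hij'⟩) rfl).symm
      -- The partner is a different pair in the same class, so it is not the representative.
      have hz : N (w j) (w i) = 0 := by
        simp only [N, Matrix.of_apply]
        rw [dif_pos hij', if_neg]
        rw [hmk, hp]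
        intro h
        exact hfix (congrArg (fun p : Inversions w => p.1.1) h)
      rw [hz, hNij, if_neg hfix]
      ring

/-- That the coordinates are off-diagonal entries is recorded for the boundedness of the cell. -/
theorem exists_tangentSpace_equiv (hinv : signedPerm w ε * signedPerm w ε = 1) :
    ∃ L : tangentSpace w ε ≃ₗ[ℝ] EuclideanSpace ℝ (Fin (cellDim w)),
      ∀ M q, ∃ i j, i ≠ j ∧ L M q = (M : Matrix (Fin n) (Fin n) ℝ) i j := by
  let e : InversionClasses w ≃ Fin (cellDim w) := Finite.equivFin _
  let L := (LinearEquiv.ofBijective (tangentCoords w ε)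
    ⟨tangentCoords_injective hinv, tangentCoords_surjective hinv⟩).trans
      ((LinearEquiv.funCongrLeft ℝ ℝ e.symm).trans (WithLp.linearEquiv 2 ℝ _).symm)
  exact ⟨L, fun M q => ⟨_, _, (Quot.out (e.symm q)).2.1.ne, rfl⟩⟩

theorem finrank_direction_affineSpan (hinv : signedPerm w ε * signedPerm w ε = 1) :
    Module.finrank ℝ (affineSpan ℝ (normalMatrices w ε)).direction = cellDim w := by
  obtain ⟨L, -⟩ := exists_tangentSpace_equiv hinv
  rw [direction_affineSpan, vectorSpan_normalMatrices hinv, L.finrank_eq, finrank_euclideanSpace,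
    Fintype.card_fin]

theorem nonempty_homeomorph_unitBall {E : Type*} [NormedAddCommGroup E] [NormedSpace ℝ E]
    {S : Set E} (hc : Convex ℝ S) (ho : IsOpen S) (hne : S.Nonempty)
    (hb : Bornology.IsBounded S) : Nonempty (S ≃ₜ Metric.ball (0 : E) 1) := by
  obtain ⟨h, hS, -⟩ := exists_homeomorph_image_interior_closure_frontier_eq_unitBall hc
    (by rwa [ho.interior_eq]) hb
  rw [ho.interior_eq] at hS
  exact ⟨(h.image S).trans (Homeomorph.setCongr hS)⟩

theorem nonempty_normalMatrices_homeomorph_ball (hinv : signedPerm w ε * signedPerm w ε = 1) :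
    Nonempty (normalMatrices w ε ≃ₜ Metric.ball (0 : EuclideanSpace ℝ (Fin (cellDim w))) 1) := by
  obtain ⟨L, hL⟩ := exists_tangentSpace_equiv hinv
  have : FiniteDimensional ℝ (tangentSpace w ε) := L.symm.finiteDimensional
  have hLc : Continuous L := L.toLinearMap.continuous_of_finiteDimensional
  have hLc' : Continuous L.symm := L.symm.toLinearMap.continuous_of_finiteDimensional
  let f : EuclideanSpace ℝ (Fin (cellDim w)) → Matrix (Fin n) (Fin n) ℝ :=
    fun x => 1 + (L.symm x : Matrix (Fin n) (Fin n) ℝ)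
  have hf : Continuous f := continuous_const.add (continuous_subtype_val.comp hLc')
  have hfm : ∀ x, f x - 1 ∈ tangentSpace w ε := fun x => by simp [f]
  let S : Set (EuclideanSpace ℝ (Fin (cellDim w))) := f ⁻¹' normalMatrices w ε
  have hopen : IsOpen S := by
    convert isOpen_pos_quadratic.preimage hf using 1
    ext x
    exact mem_normalMatrices_iff_pos_on_sphere hinv (hfm x)
  have hconv : Convex ℝ S := by
    intro x hx y hy a b ha hb hab
    have h := convex_normalMatrices (Set.mem_preimage.1 hx) (Set.mem_preimage.1 hy) ha hb hab
    have : f (a • x + b • y) = a • f x + b • f y := by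
      simp only [f, map_add, map_smul, Submodule.coe_add, Submodule.coe_smul, smul_add]
      rw [add_add_add_comm, ← add_smul, hab, one_smul]
    change f (a • x + b • y) ∈ normalMatrices w ε
    rwa [this]
  have hne : S.Nonempty := ⟨0, by simpa [S, f] using one_mem_normalMatrices hinv⟩
  have hbdd : Bornology.IsBounded S := by
    refine isBounded_iff_forall_norm_le.2 ⟨Real.sqrt (cellDim w), fun x hx => ?_⟩
    rw [EuclideanSpace.norm_eq]
    refine Real.sqrt_le_sqrt ?_
    calc ∑ q, ‖x q‖ ^ 2 ≤ ∑ _q : Fin (cellDim w), (1 : ℝ) := by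
          refine Finset.sum_le_sum fun q _ => pow_le_one₀ (norm_nonneg _) ?_
          obtain ⟨i, j, hij, h⟩ := hL (L.symm x) q
          have hfx : f x i j = (L.symm x : Matrix (Fin n) (Fin n) ℝ) i j := by
            simp [f, Matrix.one_apply_ne hij]
          rw [L.apply_symm_apply, ← hfx] at h
          rw [h, Real.norm_eq_abs]
          exact abs_entry_le_one hx.1 hx.2.2.1 i j
      _ = cellDim w := by simp
  obtain ⟨h⟩ := nonempty_homeomorph_unitBall hconv hopen hne hbdd
  have hsub : ∀ A : normalMatrices w ε, (A : Matrix (Fin n) (Fin n) ℝ) - 1 ∈ tangentSpace w ε :=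
    fun A => ((mem_normalMatrices_iff_sub_one_mem hinv).1 A.2).1
  have hfL : ∀ A : normalMatrices w ε, f (L ⟨A - 1, hsub A⟩) = A := fun A => by simp [f]
  have hLS : ∀ A : normalMatrices w ε, L ⟨A - 1, hsub A⟩ ∈ S := fun A => by
    rw [Set.mem_preimage, hfL]; exact A.2
  let e : normalMatrices w ε ≃ₜ S := {
    toFun := fun A => ⟨L ⟨A - 1, hsub A⟩, hLS A⟩
    invFun := fun x => ⟨f x, x.2⟩
    left_inv := fun A => Subtype.ext (hfL A)
    right_inv := fun x => Subtype.ext (by simp [f])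
    continuous_toFun := (hLc.comp ((continuous_subtype_val.sub continuous_const).subtype_mk
      hsub)).subtype_mk hLS
    continuous_invFun := (hf.comp continuous_subtype_val).subtype_mk _ }
  exact ⟨e.trans h⟩

end Dimension

end BruhatGrassmann

theorem mainTheorem2 (n k : ℕ) (w : Equiv.Perm (Fin n)) (ε : Fin n → ℤˣ)
    (hinv : BruhatGrassmann.signedPerm w ε * BruhatGrassmann.signedPerm w ε = 1)
    (htr : (BruhatGrassmann.signedPerm w ε).trace = (n : ℝ) - 2 * (k : ℝ)) :
    -- the set of normal forms is convex, open in its affine span, and of the stated dimension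
    (BruhatGrassmann.normalMatrices w ε).Nonempty ∧
    Convex ℝ (BruhatGrassmann.normalMatrices w ε) ∧
    IsOpen {x : affineSpan ℝ (BruhatGrassmann.normalMatrices w ε) |
      (x : Matrix (Fin n) (Fin n) ℝ) ∈ BruhatGrassmann.normalMatrices w ε} ∧
    Module.finrank ℝ (affineSpan ℝ (BruhatGrassmann.normalMatrices w ε)).direction =
      BruhatGrassmann.cellDim w ∧
    -- the homeomorphism given by Cholesky factorization
    (∀ A ∈ BruhatGrassmann.normalMatrices w ε, ∃! a, BruhatGrassmann.IsCholesky A a) ∧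
    (∃ Φ : BruhatGrassmann.normalMatrices w ε ≃ₜ
        BruhatGrassmann.bruhatCell k (BruhatGrassmann.signedPerm w ε),
      ∀ (A : BruhatGrassmann.normalMatrices w ε) (a : Matrix (Fin n) (Fin n) ℝ),
        BruhatGrassmann.IsCholesky (A : Matrix (Fin n) (Fin n) ℝ) a →
          (Φ A : Matrix (Fin n) (Fin n) ℝ) = a * BruhatGrassmann.signedPerm w ε * a⁻¹) ∧
    -- the Bruhat cell is an open cell of the stated dimension
    Nonempty (BruhatGrassmann.bruhatCell k (BruhatGrassmann.signedPerm w ε) ≃ₜ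
      Metric.ball (0 : EuclideanSpace ℝ (Fin (BruhatGrassmann.cellDim w))) 1) := by
  obtain ⟨Φ, hΦ⟩ := BruhatGrassmann.exists_homeomorph_bruhatCell hinv htr
  obtain ⟨Ψ⟩ := BruhatGrassmann.nonempty_normalMatrices_homeomorph_ball hinv
  refine ⟨⟨1, BruhatGrassmann.one_mem_normalMatrices hinv⟩, BruhatGrassmann.convex_normalMatrices,
    BruhatGrassmann.isOpen_normalMatrices hinv, BruhatGrassmann.finrank_direction_affineSpan hinv,
    fun A hA => ?_, ⟨Φ, hΦ⟩, ⟨Φ.symm.trans Ψ⟩⟩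
  obtain ⟨a, ha⟩ := BruhatGrassmann.exists_isCholesky hA.1
  exact ⟨a, ha, fun b hb => hb.unique ha⟩
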